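/- For a countable set $\Lambda\subset\mathbb R$ let $\delta_\Lambda=\sum_{\lambda\in\Lambda}\delta_\lambda$. For $\varphi$ in the Schwartz class let $\hat\varphi(t)=\int_{\mathbb R}\varphi(x)e^{-2\pi i t x}\,dx$, and for a tempered distribution $\alpha$ on $\mathbb R$ let $\hat\alpha$ be defined by $\hat\alpha(\varphi)=\alpha(\hat\varphi)$. Theorem. For every $\varepsilon>0$ there is a set $\Lambda\subset\mathbb R$ of the form $$\Lambda=\bigcup_{n\in\mathbb Z}\Lambda_n,\qquad \Lambda_n\subset(n-\varepsilon,n+\varepsilon),\qquad \#\Lambda_n=n^2+1,$$ such that the measure $\delta_\Lambda$ is a tempered distribution and $$\hat\delta_\Lambda=\delta_0-\frac{\delta_0''}{4\pi^2}\quad\text{in }\left(-\tfrac12,\tfrac12\right),$$ that is, $\hat\delta_\Lambda(\varphi)=\varphi(0)-\frac{\varphi''(0)}{4\pi^2}$ for every Schwartz function $\varphi$ whose closed support is contained in $(-\frac12,\frac12)$. -/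

import Mathlib

open MeasureTheory Set
open scoped SchwartzMap FourierTransform

/-- The measure `δ_Λ = ∑_{x ∈ Λ} δ_x`, a unit mass at each point of `Λ`. -/
noncomputable def deltaMeasure (Λ : Set ℝ) : Measure ℝ :=
  Measure.sum fun x : Λ => Measure.dirac (x : ℝ)

/-- Two tempered distributions on `ℝ` are equal in the set `U` (meant for open `U`): they agree
on every Schwartz function whose closed support is contained in `U`. -/
def EqualIn (S T : 𝓢'(ℝ, ℂ)) (U : Set ℝ) : Prop :=
  Distribution.IsVanishingOn (⇑(S - T)) U

/-- `Λ` is a union of finite sets `Λ_n`, `n ∈ ℤ`, with `Λ_n ⊆ (n - ε, n + ε)` and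
`#Λ_n = n ^ 2 + 1`. -/
def IsSquareCluster (ε : ℝ) (Λ : Set ℝ) : Prop :=
  ∃ P : ℤ → Finset ℝ,
    Λ = ⋃ n : ℤ, (P n : Set ℝ) ∧
    ∀ n : ℤ, (P n : Set ℝ) ⊆ Ioo ((n : ℝ) - ε) ((n : ℝ) + ε) ∧
      ((P n).card : ℤ) = n ^ 2 + 1

open scoped lp Nat
open AddCircle Complex

/-! Poisson summation applied to `f - f'' / (4π²)` gives the required value for the sum of `(n² + 1)
𝓕 f n`. So it suffices to split the mass `n² + 1` at `n` into distinct points `n + x n i` without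
changing the sum of `𝓕 f` over all points, for every `f` supported in `(-1/2, 1/2)`.

On that interval `𝓕 f` at the integers is the `ℓ²` sequence `v` of Fourier coefficients, and
differentiating `𝓕 f` becomes a bounded operator `M`, multiplication by `-2πit`. Taylor expansion at
each `n` turns the total change into `∑ n, ∑ k, P k n * (M ^ (k + 1) v) n`, where `P k n = ∑ i, x n
i ^ (k + 1) / (k + 1)!`. Moving powers of `M` to the other side, this vanishes for all `v` once `∑
k, (M†) ^ k (P k) = 0`, a condition free of `f`.

To solve it, take `x n i = d n i + w n / N n` with `d n` tiny, distinct and of zero sum. Then `P 0 =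
w`, while the higher `P k` are small and Lipschitz in `w`, uniformly in the cluster sizes; the
equation is a fixed-point problem for a contraction on a small ball of `ℓ²`
(`exists_hasSum_pow_apply_eq_zero`). The points are real because `M` has a real matrix, so the
iteration stays among real sequences. -/

/-- A contraction argument for the equation `∑ k, A ^ k (Ψ k w) = 0`, where `Ψ 0` is the identity
and the higher terms are small. -/
theorem exists_hasSum_pow_apply_eq_zero {E : Type*} [NormedAddCommGroup E] [NormedSpace ℂ E]
    [CompleteSpace E] (A : E →L[ℂ] E) (S : AddSubgroup E) (hS : IsClosed (S : Set E))
    (hAS : ∀ w ∈ S, A w ∈ S) {ρ r : ℝ} (hρ : 0 ≤ ρ) (hr : 0 ≤ r) (hA : ‖A‖ * ρ ≤ 1 / 4)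
    (Ψ : ℕ → E → E) (hΨS : ∀ k, ∀ w ∈ S, ‖w‖ ≤ r → Ψ k w ∈ S)
    (hΨ0 : ∀ w, ‖w‖ ≤ r → Ψ 0 w = w)
    (hΨ : ∀ k w, ‖w‖ ≤ r → ‖Ψ k w‖ ≤ ρ ^ k * (2 * r))
    (hΨL : ∀ k w w', ‖w‖ ≤ r → ‖w'‖ ≤ r → ‖Ψ k w - Ψ k w'‖ ≤ ρ ^ k * ‖w - w'‖) :
    ∃ w ∈ S, ‖w‖ ≤ r ∧ HasSum (fun k => (A ^ k) (Ψ k w)) 0 := by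
  have hpow : ∀ (k : ℕ) (x : E), ‖(A ^ k) x‖ ≤ ‖A‖ ^ k * ‖x‖ := by
    intro k x
    induction k with
    | zero => simp
    | succ k ih =>
      rw [pow_succ' A, pow_succ', mul_assoc]
      exact (A.le_opNorm _).trans (mul_le_mul_of_nonneg_left ih (norm_nonneg _))
  have hpowS : ∀ (k : ℕ), ∀ x ∈ S, (A ^ k) x ∈ S := by
    intro k x hx
    induction k with
    | zero => simpa
    | succ k ih =>
      rw [pow_succ']
      exact hAS _ ih
  have hterm : ∀ (k : ℕ) (x : E) (C : ℝ), 0 ≤ C → ‖x‖ ≤ ρ ^ k * C →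
      ‖(A ^ k) x‖ ≤ (1 / 4) ^ k * C := by
    intro k x C hC hx
    calc ‖(A ^ k) x‖ ≤ ‖A‖ ^ k * (ρ ^ k * C) := (hpow k x).trans (by gcongr)
      _ = (‖A‖ * ρ) ^ k * C := by rw [mul_pow]; ring
      _ ≤ _ := by gcongr
  -- Without the `k = 0` term the geometric sum is `1/3`: this gives the Lipschitz constant `1/3`,
  -- and the bound `2r/3 ≤ r` for the self-map.
  have hgeo : ∀ C : ℝ, HasSum (fun k : ℕ => (1 / 4 : ℝ) ^ (k + 1) * C) (C / 3) := by
    intro C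
    have e₁ : C / 3 = 1 / 4 * C * (1 - 1 / 4)⁻¹ := by norm_num; ring
    have e₂ : (fun k : ℕ => (1 / 4 : ℝ) ^ (k + 1) * C) = fun k => 1 / 4 * C * (1 / 4) ^ k := by
      ext k; ring
    rw [e₁, e₂]
    exact (hasSum_geometric_of_lt_one (by norm_num) (by norm_num)).mul_left (1 / 4 * C)
  -- Since `Ψ 0 w = w`, the equation reads `w = Φ w`.
  set Φ : E → E := fun w => -∑' k, (A ^ (k + 1)) (Ψ (k + 1) w) with hΦ
  have hsum : ∀ w, ‖w‖ ≤ r → Summable (fun k => (A ^ (k + 1)) (Ψ (k + 1) w)) := fun w hw =>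
    Summable.of_norm_bounded (hgeo (2 * r)).summable
      fun k => hterm _ _ _ (by positivity) (hΨ _ _ hw)
  set T : Set E := {w | w ∈ S ∧ ‖w‖ ≤ r} with hT
  have hTc : IsComplete T :=
    (hS.inter (isClosed_le continuous_norm continuous_const)).isComplete
  have hmaps : MapsTo Φ T T := by
    rintro w ⟨hwS, hw⟩
    refine ⟨S.neg_mem ?_, ?_⟩
    · refine hS.mem_of_tendsto (hsum w hw).hasSum (Filter.Eventually.of_forall fun s => ?_)
      exact S.sum_mem fun k _ => hpowS _ _ (hΨS _ _ hwS hw)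
    · rw [hΦ, norm_neg]
      refine (tsum_of_norm_bounded (hgeo (2 * r)) fun k =>
        hterm _ _ _ (by positivity) (hΨ _ _ hw)).trans ?_
      linarith
  have hcon : ContractingWith (1 / 3) (hmaps.restrict Φ T T) := by
    refine ⟨by rw [← NNReal.coe_lt_coe]; norm_num, LipschitzWith.of_dist_le_mul ?_⟩
    rintro ⟨w, hwS, hw⟩ ⟨w', hwS', hw'⟩
    rw [Subtype.dist_eq, Subtype.dist_eq, dist_eq_norm, dist_eq_norm]
    change ‖Φ w - Φ w'‖ ≤ _ * ‖w - w'‖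
    have : Φ w - Φ w' = -∑' k, (A ^ (k + 1)) (Ψ (k + 1) w - Ψ (k + 1) w') := by
      simp only [hΦ, map_sub]
      rw [(hsum w hw).tsum_sub (hsum w' hw')]
      abel
    rw [this, norm_neg]
    refine (tsum_of_norm_bounded (hgeo ‖w - w'‖) fun k =>
        hterm _ _ _ (by positivity) (hΨL _ _ _ hw hw')).trans (le_of_eq ?_)
    push_cast; ring
  obtain ⟨w, ⟨hwS, hw⟩, hfix, -⟩ := hcon.exists_fixedPoint' hTc hmaps
    (x := 0) ⟨S.zero_mem, by simpa⟩ (edist_ne_top _ _)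
  refine ⟨w, hwS, hw, ?_⟩
  rw [← hasSum_nat_add_iff' 1]
  have h1 : Φ w = w := hfix
  have h2 := (hsum w hw).hasSum
  simp only [Finset.range_one, Finset.sum_singleton, pow_zero, hΨ0 w hw,
    one_apply_eq_self, zero_sub]
  convert h2 using 1
  rw [← h1, hΦ, neg_neg, ← hΦ, h1]

theorem norm_pow_succ_sub_pow_succ_le {x y : ℂ} {ρ : ℝ} (hx : ‖x‖ ≤ ρ) (hy : ‖y‖ ≤ ρ) (k : ℕ) :
    ‖x ^ (k + 1) - y ^ (k + 1)‖ ≤ (k + 1) * ρ ^ k * ‖x - y‖ := by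
  have hρ : 0 ≤ ρ := (norm_nonneg _).trans hx
  induction k with
  | zero => simp
  | succ k ih =>
    have : x ^ (k + 1 + 1) - y ^ (k + 1 + 1) =
      x * (x ^ (k + 1) - y ^ (k + 1)) + (x - y) * y ^ (k + 1) := by ring
    rw [this]
    calc _ ≤ ‖x‖ * ‖x ^ (k + 1) - y ^ (k + 1)‖ + ‖x - y‖ * ‖y‖ ^ (k + 1) :=
          (norm_add_le _ _).trans (by rw [norm_mul, norm_mul, norm_pow])
      _ ≤ ρ * ((k + 1) * ρ ^ k * ‖x - y‖) + ‖x - y‖ * ρ ^ (k + 1) := by gcongr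
      _ = _ := by push_cast; ring

/-! ### Real sequences in `ℓ²` -/

/-- The real sequences in `ℓ²(ℤ, ℂ)`. -/
def realSeq : AddSubgroup ℓ²(ℤ, ℂ) where
  carrier := {w | ∀ n, (w n).im = 0}
  add_mem' := by
    intro a b ha hb n
    simp [ha n, hb n]
  zero_mem' := by intro n; simp
  neg_mem' := by
    intro a ha n
    simp [ha n]

theorem mem_realSeq {w : ℓ²(ℤ, ℂ)} : w ∈ realSeq ↔ ∀ n, (w n).im = 0 := Iff.rfl

theorem isClosed_realSeq : IsClosed (realSeq : Set ℓ²(ℤ, ℂ)) := by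
  have : (realSeq : Set ℓ²(ℤ, ℂ)) = ⋂ n : ℤ, {w | (w n).im = 0} := by
    ext w; simp [mem_realSeq]
  rw [this]
  refine isClosed_iInter fun n => isClosed_eq (Complex.continuous_im.comp ?_) continuous_const
  exact (lp.lipschitzWith_one_eval 2 n).continuous

/-- An operator on `ℓ²(ℤ, ℂ)` with real matrix coefficients has an adjoint preserving the real
sequences. -/
theorem adjoint_mem_realSeq {M : ℓ²(ℤ, ℂ) →L[ℂ] ℓ²(ℤ, ℂ)}
    (hM : ∀ n, M (lp.single 2 n 1) ∈ realSeq) {w : ℓ²(ℤ, ℂ)} (hw : w ∈ realSeq) :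
    ContinuousLinearMap.adjoint M w ∈ realSeq := by
  intro n
  have h1 : ContinuousLinearMap.adjoint M w n =
      inner ℂ (M (lp.single 2 n (1 : ℂ))) w := by
    rw [← ContinuousLinearMap.adjoint_inner_right, lp.inner_single_left]
    simp
  have h2 := (lp.hasSum_inner (𝕜 := ℂ) (M (lp.single 2 n (1 : ℂ))) w).mapL Complex.imCLM
  rw [h1]
  refine h2.unique ?_
  convert hasSum_zero with m
  simp [hw m, hM n m]

/-- A sequence dominated by an element of `ℓ²`. -/
theorem lp.memℓp_and_norm_le_of_le {a : ℤ → ℂ} {C : ℝ} (hC : 0 ≤ C) (u : ℓ²(ℤ, ℂ))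
    (h : ∀ n, ‖a n‖ ≤ C * ‖u n‖) :
    ∃ ha : Memℓp a 2, ‖(⟨a, ha⟩ : ℓ²(ℤ, ℂ))‖ ≤ C * ‖u‖ := by
  have h' : ∀ n, ‖a n‖ ≤ ‖((C : ℂ) • u) n‖ := by
    intro n
    rw [lp.coeFn_smul, Pi.smul_apply, norm_smul, Complex.norm_real, Real.norm_of_nonneg hC]
    exact h n
  refine ⟨(lp.memℓp ((C : ℂ) • u)).mono' h', ?_⟩
  refine (lp.norm_mono (y := (C : ℂ) • u) (by norm_num) h').trans (le_of_eq ?_)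
  rw [norm_smul, Complex.norm_real, Real.norm_of_nonneg hC]

/-! ### Clusters and their power sums -/

/-- Small clusters of distinct real numbers with prescribed cardinalities and zero sums. -/
theorem exists_centered_clusters (N : ℤ → ℕ) {r : ℝ} (hr : 0 < r) :
    ∃ (d : ∀ n, Fin (N n) → ℝ) (u : ℓ²(ℤ, ℂ)), (∀ n, Function.Injective (d n)) ∧
      (∀ n, ∑ i, d n i = 0) ∧ (∀ n, ∑ i, |d n i| ≤ ‖u n‖) ∧ ‖u‖ ≤ r := by
  obtain ⟨s, hs0, c, hsc, hcr⟩ := posSumOfEncodable hr ℤ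
  have hsr : ∀ n, s n ≤ r := fun n =>
    (le_hasSum hsc n fun m _ => (hs0 m).le).trans hcr
  have hsq : Summable fun n => s n ^ 2 := by
    refine Summable.of_nonneg_of_le (fun n => sq_nonneg _) (fun n => ?_) (hsc.summable.mul_left r)
    rw [sq]
    exact mul_le_mul_of_nonneg_right (hsr n) (hs0 n).le
  have hmem : Memℓp (fun n => (s n : ℂ)) 2 := by
    apply memℓp_gen
    simpa using hsq
  -- Equally spaced points symmetric about `0`. Each is at most `s n / N n` in size, so a cluster
  -- has total size at most `s n` whatever its cardinality.
  refine ⟨fun n i => s n / N n ^ 2 * (2 * i - (N n - 1)), ⟨_, hmem⟩, ?_, ?_, ?_, ?_⟩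
  · intro n i j hij
    have hN : (0 : ℝ) < N n := by exact_mod_cast i.pos
    have h1 : s n / N n ^ 2 ≠ 0 := (div_pos (hs0 n) (by positivity)).ne'
    have h2 := mul_left_cancel₀ h1 hij
    have h3 : ((i : ℕ) : ℝ) = (j : ℕ) := by linarith
    exact Fin.ext (by exact_mod_cast h3)
  · intro n
    have key : ∀ m : ℕ, ∑ i ∈ Finset.range m, (2 * (i : ℝ)) = m * (m - 1) := by
      intro m
      induction m with
      | zero => simp
      | succ m ih => rw [Finset.sum_range_succ, ih]; push_cast; ring
    rw [← Finset.mul_sum, Fin.sum_univ_eq_sum_range (fun i : ℕ => 2 * (i : ℝ) - (N n - 1)),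
      Finset.sum_sub_distrib, key, Finset.sum_const, Finset.card_range, nsmul_eq_mul, sub_self,
      mul_zero]
  · intro n
    have : ∀ i : Fin (N n), |s n / N n ^ 2 * (2 * (i : ℝ) - (N n - 1))| ≤ s n / N n := by
      intro i
      have hN : (0 : ℝ) < N n := by exact_mod_cast i.pos
      have hi : ((i : ℕ) : ℝ) + 1 ≤ N n := by exact_mod_cast i.isLt
      have hi0 : (0 : ℝ) ≤ ((i : ℕ) : ℝ) := by positivity
      rw [abs_mul, abs_of_pos (div_pos (hs0 n) (by positivity))]
      calc s n / N n ^ 2 * |2 * (i : ℝ) - (N n - 1)| ≤ s n / N n ^ 2 * N n := by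
            have := (hs0 n).le
            gcongr
            rw [abs_le]
            constructor <;> linarith
        _ = s n / N n := by field_simp
    have hn : ‖(s n : ℂ)‖ = s n := by
      rw [Complex.norm_real, Real.norm_of_nonneg (hs0 n).le]
    refine (Finset.sum_le_sum fun i _ => this i).trans ?_
    change _ ≤ ‖(s n : ℂ)‖
    rw [hn, Finset.sum_const, Finset.card_univ, Fintype.card_fin, nsmul_eq_mul]
    rcases Nat.eq_zero_or_pos (N n) with h | h
    · simp [h, (hs0 n).le]
    · have hN : (N n : ℝ) ≠ 0 := by positivity
      rw [mul_div_cancel₀ _ hN]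
  · refine lp.norm_le_of_forall_sum_le (by norm_num) hr.le fun t => ?_
    have : ∑ n ∈ t, s n ≤ r := (sum_le_hasSum t (fun m _ => (hs0 m).le) hsc).trans hcr
    calc ∑ n ∈ t, ‖(s n : ℂ)‖ ^ (2 : ENNReal).toReal ≤ ∑ n ∈ t, r * s n := by
          refine Finset.sum_le_sum fun n _ => ?_
          simp only [ENNReal.toReal_ofNat, Real.rpow_ofNat, Complex.norm_real, Real.norm_eq_abs,
            sq_abs]
          rw [sq]
          exact mul_le_mul_of_nonneg_right (hsr n) (hs0 n).le
      _ ≤ r ^ (2 : ENNReal).toReal := by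
          rw [← Finset.mul_sum]
          simp only [ENNReal.toReal_ofNat, Real.rpow_ofNat, sq]
          gcongr

/-- The `k + 1`-st normalized power sum of a cluster `d` shifted by the mean shift `z / N`. -/
noncomputable def shiftedPowerSum {N : ℕ} (d : Fin N → ℝ) (k : ℕ) (z : ℂ) : ℂ :=
  ∑ i, ((d i : ℂ) + z / N) ^ (k + 1) / (k + 1)!

/-- Centering removes the contribution of `d`, so the leading term of the equation is exactly the
unknown. -/
theorem shiftedPowerSum_zero {N : ℕ} (hN : 0 < N) {d : Fin N → ℝ} (hd : ∑ i, d i = 0) (z : ℂ) :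
    shiftedPowerSum d 0 z = z := by
  have hN' : (N : ℂ) ≠ 0 := by exact_mod_cast hN.ne'
  have : ∑ i, (d i : ℂ) = 0 := by exact_mod_cast hd
  simp [shiftedPowerSum, Finset.sum_add_distrib, this, mul_div_cancel₀ _ hN']

theorem shiftedPowerSum_ofReal_im {N : ℕ} (d : Fin N → ℝ) (k : ℕ) {z : ℂ} (hz : z.im = 0) :
    (shiftedPowerSum d k z).im = 0 := by
  obtain ⟨y, rfl⟩ : ∃ y : ℝ, z = y := ⟨z.re, Complex.ext rfl (by simpa using hz)⟩
  have : shiftedPowerSum d k y = ((∑ i, (d i + y / N) ^ (k + 1) / (k + 1)! : ℝ) : ℂ) := by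
    simp [shiftedPowerSum]
  rw [this, Complex.ofReal_im]

theorem norm_add_div_le {N : ℕ} {d : Fin N → ℝ} {r : ℝ} (hd : ∑ i, |d i| ≤ r) {z : ℂ}
    (hz : ‖z‖ ≤ r) (i : Fin N) : ‖(d i : ℂ) + z / N‖ ≤ 2 * r := by
  have h1 : |d i| ≤ r :=
    (Finset.single_le_sum (f := fun i => |d i|) (fun _ _ => abs_nonneg _)
      (Finset.mem_univ i)).trans hd
  have hN : (1 : ℝ) ≤ N := by exact_mod_cast i.pos
  have h2 : ‖z‖ / N ≤ r := (div_le_self (norm_nonneg _) hN).trans hz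
  calc _ ≤ ‖(d i : ℂ)‖ + ‖z / N‖ := norm_add_le _ _
    _ ≤ 2 * r := by
      rw [Complex.norm_real, Real.norm_eq_abs, norm_div, Complex.norm_natCast]
      linarith

/-- Each of the `N` points moves by only `‖z - z'‖ / N`, so the bound is independent of `N`; the
factor `k + 1` from differencing the power is absorbed by `(k + 1)!`. This uniformity is what allows
unbounded cluster sizes. -/
theorem norm_shiftedPowerSum_sub_le {N : ℕ} {d : Fin N → ℝ} {r : ℝ}
    (hd : ∑ i, |d i| ≤ r) {z z' : ℂ} (hz : ‖z‖ ≤ r) (hz' : ‖z'‖ ≤ r) (k : ℕ) :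
    ‖shiftedPowerSum d k z - shiftedPowerSum d k z'‖ ≤ (2 * r) ^ k * ‖z - z'‖ := by
  have hr : 0 ≤ r := (norm_nonneg _).trans hz
  rcases Nat.eq_zero_or_pos N with rfl | hN
  · simp only [shiftedPowerSum, Finset.univ_eq_empty, Finset.sum_empty, sub_self, norm_zero]
    positivity
  have hN' : (0 : ℝ) < N := by exact_mod_cast hN
  rw [shiftedPowerSum, shiftedPowerSum, ← Finset.sum_sub_distrib]
  have key : ∀ i ∈ Finset.univ, ‖((d i : ℂ) + z / N) ^ (k + 1) / (k + 1)! -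
      ((d i : ℂ) + z' / N) ^ (k + 1) / (k + 1)!‖ ≤ (2 * r) ^ k * (‖z - z'‖ / N) := by
    intro i _
    have h1 := norm_pow_succ_sub_pow_succ_le (norm_add_div_le hd hz i)
      (norm_add_div_le hd hz' i) k
    have h2 : (d i : ℂ) + z / N - (d i + z' / N) = (z - z') / N := by ring
    rw [h2, norm_div, Complex.norm_natCast] at h1
    have h3 : ((k : ℝ) + 1) ≤ (k + 1)! := by exact_mod_cast Nat.self_le_factorial (k + 1)
    rw [← sub_div, norm_div, Complex.norm_natCast, div_le_iff₀ (by positivity)]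
    calc _ ≤ _ := h1
      _ = ((2 * r) ^ k * (‖z - z'‖ / N)) * (k + 1) := by ring
      _ ≤ _ := by gcongr
  refine (norm_sum_le_of_le _ key).trans (le_of_eq ?_)
  rw [Finset.sum_const, Finset.card_univ, Fintype.card_fin, nsmul_eq_mul]
  field_simp

/-- Keeping the factor `∑ i, |d i|` makes these values square summable in `n`. -/
theorem norm_shiftedPowerSum_zero_le {N : ℕ} {d : Fin N → ℝ} {r : ℝ}
    (hd : ∑ i, |d i| ≤ r) (k : ℕ) :
    ‖shiftedPowerSum d k 0‖ ≤ (2 * r) ^ k * ∑ i, |d i| := by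
  have hr : 0 ≤ r := (Finset.sum_nonneg fun _ _ => abs_nonneg _).trans hd
  rw [shiftedPowerSum, Finset.mul_sum]
  refine norm_sum_le_of_le _ fun i _ => ?_
  have h1 := norm_add_div_le hd (z := 0) (by simpa) i
  simp only [zero_div, add_zero, Complex.norm_real, Real.norm_eq_abs] at h1 ⊢
  rw [norm_div, norm_pow, Complex.norm_natCast, Complex.norm_real, Real.norm_eq_abs]
  have h3 : (1 : ℝ) ≤ (k + 1)! := by exact_mod_cast Nat.succ_le_of_lt (Nat.factorial_pos _)
  refine (div_le_self (by positivity) h3).trans ?_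
  rw [pow_succ]
  gcongr

/-! ### Annihilating clusters -/

/-- If `∑ k, (M†) ^ k (P k) = 0` for real sequences `P k`, then pairing with `M v` and exchanging
the order of summation gives a vanishing sum over `ℤ`. -/
theorem hasSum_tsum_mul_pow_apply (M : ℓ²(ℤ, ℂ) →L[ℂ] ℓ²(ℤ, ℂ)) (P : ℕ → ℓ²(ℤ, ℂ))
    (hP : ∀ k, P k ∈ realSeq) {ρ C : ℝ} (hρ : 0 ≤ ρ) (hC : 0 ≤ C) (hB : ∀ k, ‖P k‖ ≤ ρ ^ k * C)
    (hM : ‖M‖ * ρ ≤ 1 / 4) (hsum : HasSum (fun k => (ContinuousLinearMap.adjoint M ^ k) (P k)) 0)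
    (v : ℓ²(ℤ, ℂ)) : HasSum (fun n => ∑' k : ℕ, P k n * (M ^ (k + 1)) v n) 0 := by
  have hterm : ∀ k n, inner ℂ (P k n) ((M ^ (k + 1)) v n) = P k n * (M ^ (k + 1)) v n := by
    intro k n
    rw [RCLike.inner_apply, mul_comm, Complex.conj_eq_iff_im.2 (hP k n)]
  have hpow : ∀ k, ‖(M ^ (k + 1)) v‖ ≤ ‖M‖ ^ k * (‖M‖ * ‖v‖) := by
    intro k
    calc _ ≤ ‖M ^ (k + 1)‖ * ‖v‖ := ContinuousLinearMap.le_opNorm _ _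
      _ ≤ ‖M‖ ^ (k + 1) * ‖v‖ := by gcongr; exact norm_pow_le' _ (Nat.succ_pos k)
      _ = _ := by ring
  have hpq : (2 : ENNReal).toReal.HolderConjugate (2 : ENNReal).toReal := by
    rw [Real.holderConjugate_iff]; norm_num
  have hcs := fun k => lp.tsum_mul_le_mul_norm hpq (P k) ((M ^ (k + 1)) v)
  -- Cauchy–Schwarz in `n` and the factor `(‖M‖ ρ) ^ k ≤ (1/4) ^ k` give absolute convergence of the
  -- double sum.
  have hsumm : Summable fun p : ℕ × ℤ => P p.1 p.2 * (M ^ (p.1 + 1)) v p.2 := by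
    apply Summable.of_norm_bounded
      (g := fun p : ℕ × ℤ => ‖P p.1 p.2‖ * ‖(M ^ (p.1 + 1)) v p.2‖)
    · rw [summable_prod_of_nonneg fun p => by positivity]
      refine ⟨fun k => (hcs k).1, ?_⟩
      refine Summable.of_nonneg_of_le (fun k => tsum_nonneg fun n => by positivity)
        (fun k => (hcs k).2.trans ?_)
        ((summable_geometric_of_lt_one (r := (1 / 4 : ℝ)) (by norm_num)
          (by norm_num)).mul_right (C * (‖M‖ * ‖v‖)))
      calc ‖P k‖ * ‖(M ^ (k + 1)) v‖
          ≤ (ρ ^ k * C) * (‖M‖ ^ k * (‖M‖ * ‖v‖)) :=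
            mul_le_mul (hB k) (hpow k) (norm_nonneg _) (by positivity)
        _ = (‖M‖ * ρ) ^ k * (C * (‖M‖ * ‖v‖)) := by rw [mul_pow]; ring
        _ ≤ _ := by gcongr
    · exact fun p => (norm_mul _ _).le
  have hinner : ∀ k, HasSum (fun n => P k n * (M ^ (k + 1)) v n)
      (inner ℂ (P k) ((M ^ (k + 1)) v)) := by
    intro k
    simpa only [hterm] using lp.hasSum_inner (𝕜 := ℂ) (P k) ((M ^ (k + 1)) v)
  have hadj : ∀ k (a b : ℓ²(ℤ, ℂ)), inner ℂ ((ContinuousLinearMap.adjoint M ^ k) a) b =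
      inner ℂ a ((M ^ k) b) := by
    intro k a b
    rw [← ContinuousLinearMap.star_eq_adjoint, ← star_pow, ContinuousLinearMap.star_eq_adjoint,
      ContinuousLinearMap.adjoint_inner_left]
  have htot : HasSum (fun p : ℕ × ℤ => P p.1 p.2 * (M ^ (p.1 + 1)) v p.2) 0 := by
    have h1 := hsumm.hasSum.prod_fiberwise hinner
    have h2 : HasSum (fun k => inner ℂ (P k) ((M ^ (k + 1)) v)) (0 : ℂ) := by
      have h3 := (hsum.mapL (innerSL ℂ (M v))).star
      simp only [map_zero, star_zero, innerSL_apply_apply] at h3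
      have h4 : ∀ k, star (inner ℂ (M v) ((ContinuousLinearMap.adjoint M ^ k) (P k))) =
          inner ℂ (P k) ((M ^ (k + 1)) v) := by
        intro k
        rw [← starRingEnd_apply, inner_conj_symm, hadj, pow_succ]
        rfl
      simpa only [h4] using h3
    rw [← h1.unique h2]
    exact hsumm.hasSum
  exact ((Equiv.prodComm ℤ ℕ).hasSum_iff.2 htot).prod_fiberwise fun n =>
    (hsumm.prod_symm.prod_factor n).hasSum

/-- Clusters of distinct small reals annihilating every `∑ n, ∑ k, p_{k+1}(n) (M ^ (k + 1) v) n`,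
where the `p_k` are the normalized power sums of the clusters. -/
theorem exists_annihilating_clusters (N : ℤ → ℕ) (hN : ∀ n, 0 < N n)
    (M : ℓ²(ℤ, ℂ) →L[ℂ] ℓ²(ℤ, ℂ)) (hM : ∀ n, M (lp.single 2 n 1) ∈ realSeq)
    {ε : ℝ} (hε : 0 < ε) :
    ∃ x : ∀ n, Fin (N n) → ℝ, (∀ n, Function.Injective (x n)) ∧ (∀ n i, |x n i| < ε) ∧
      ∀ v : ℓ²(ℤ, ℂ), HasSum
        (fun n => ∑' k : ℕ, (∑ i, (x n i : ℂ) ^ (k + 1) / (k + 1)!) * (M ^ (k + 1)) v n) 0 := by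
  -- Both `d n i` and the shift are at most `r`, so `2r` bounds every point and serves as the ratio
  -- `ρ`.
  obtain ⟨r, hr, hrε, hrM⟩ : ∃ r : ℝ, 0 < r ∧ 2 * r < ε ∧ ‖M‖ * (2 * r) ≤ 1 / 4 := by
    have hpos : 0 < ‖M‖ + 1 := by positivity
    refine ⟨min (ε / 4) (1 / (8 * (‖M‖ + 1))), by positivity, ?_, ?_⟩
    · linarith [min_le_left (ε / 4) (1 / (8 * (‖M‖ + 1)))]
    · calc ‖M‖ * (2 * min (ε / 4) (1 / (8 * (‖M‖ + 1))))
          ≤ (‖M‖ + 1) * (2 * (1 / (8 * (‖M‖ + 1)))) := by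
            gcongr
            · linarith
            · exact min_le_right _ _
        _ = 1 / 4 := by field_simp; norm_num
  obtain ⟨d, u, hdinj, hdsum, hdu, hur⟩ := exists_centered_clusters N hr
  have hle : ∀ {w : ℓ²(ℤ, ℂ)}, ‖w‖ ≤ r → ∀ n, ‖w n‖ ≤ r := fun hw n =>
    (lp.norm_apply_le_norm (by norm_num) _ n).trans hw
  have hdr : ∀ n, ∑ i, |d n i| ≤ r := fun n => (hdu n).trans (hle hur n)
  have hz := fun k => lp.memℓp_and_norm_le_of_le (a := fun n => shiftedPowerSum (d n) k 0)
    (C := (2 * r) ^ k) (by positivity) u fun n =>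
      (norm_shiftedPowerSum_zero_le (hdr n) k).trans (by gcongr; exact hdu n)
  have hsub := fun k (w w' : ℓ²(ℤ, ℂ)) (hw : ‖w‖ ≤ r) (hw' : ‖w'‖ ≤ r) =>
    lp.memℓp_and_norm_le_of_le
      (a := fun n => shiftedPowerSum (d n) k (w n) - shiftedPowerSum (d n) k (w' n))
      (C := (2 * r) ^ k) (by positivity) (w - w') fun n =>
        norm_shiftedPowerSum_sub_le (hdr n) (hle hw n) (hle hw' n) k
  have hmem : ∀ k (w : ℓ²(ℤ, ℂ)), ‖w‖ ≤ r →
      Memℓp (fun n => shiftedPowerSum (d n) k (w n)) 2 := by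
    intro k w hw
    have := (hsub k w 0 hw (by simpa using hr.le)).1.add (hz k).1
    convert! this using 1
    ext n; simp
  classical
  set Ψ : ℕ → ℓ²(ℤ, ℂ) → ℓ²(ℤ, ℂ) := fun k w =>
    if h : ‖w‖ ≤ r then ⟨_, hmem k w h⟩ else 0 with hΨ
  have hΨc : ∀ k w, ‖w‖ ≤ r → ∀ n, Ψ k w n = shiftedPowerSum (d n) k (w n) := by
    intro k w hw n
    simp only [hΨ, dif_pos hw]
  have hL : ∀ k w w', ‖w‖ ≤ r → ‖w'‖ ≤ r → ‖Ψ k w - Ψ k w'‖ ≤ (2 * r) ^ k * ‖w - w'‖ := by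
    intro k w w' hw hw'
    obtain ⟨h1, h2⟩ := hsub k w w' hw hw'
    convert! h2 using 2
    ext n
    simp [hΨc k w hw, hΨc k w' hw']
  have h0r : ‖(0 : ℓ²(ℤ, ℂ))‖ ≤ r := by simpa using hr.le
  have hB : ∀ k w, ‖w‖ ≤ r → ‖Ψ k w‖ ≤ (2 * r) ^ k * (2 * r) := by
    intro k w hw
    have h1 : ‖Ψ k 0‖ ≤ (2 * r) ^ k * r := by
      obtain ⟨h1, h2⟩ := hz k
      refine le_trans (le_of_eq ?_) (h2.trans (by gcongr))
      congr 1
      ext n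
      simp [hΨc k 0 h0r]
    have h2 := hL k w 0 hw h0r
    rw [sub_zero] at h2
    have h3 : ‖Ψ k w‖ ≤ ‖Ψ k w - Ψ k 0‖ + ‖Ψ k 0‖ := by
      simpa using norm_add_le (Ψ k w - Ψ k 0) (Ψ k 0)
    have h4 : (2 * r) ^ k * ‖w‖ ≤ (2 * r) ^ k * r := by gcongr
    linarith
  obtain ⟨w, hwS, hw, hsum⟩ := exists_hasSum_pow_apply_eq_zero
    (ContinuousLinearMap.adjoint M) realSeq isClosed_realSeq
    (fun w hw => adjoint_mem_realSeq hM hw) (ρ := 2 * r) (r := r) (by positivity) hr.le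
    (by rwa [LinearIsometryEquiv.norm_map]) Ψ
    (fun k w hwS hw n => by
      rw [hΨc k w hw n]; exact shiftedPowerSum_ofReal_im _ _ (hwS n))
    (fun w hw => by
      ext n; rw [hΨc 0 w hw n]; exact shiftedPowerSum_zero (hN n) (hdsum n) _)
    hB hL
  have hwre : ∀ n, ((w n).re : ℂ) = w n := fun n => Complex.ext rfl (by simp [hwS n])
  have hx : ∀ n i, ((d n i + (w n).re / N n : ℝ) : ℂ) = d n i + w n / N n := by
    intro n i
    push_cast
    rw [hwre]
  refine ⟨fun n i => d n i + (w n).re / N n, fun n i j hij => hdinj n ?_, fun n i => ?_,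
    fun v => ?_⟩
  · simpa using hij
  · refine lt_of_le_of_lt ?_ hrε
    rw [← Real.norm_eq_abs, ← Complex.norm_real, hx]
    exact norm_add_div_le (hdr n) (hle hw n) i
  · simp only [hx]
    have hfin := hasSum_tsum_mul_pow_apply M (fun k => Ψ k w) (fun k n => by
      rw [hΨc k w hw n]; exact shiftedPowerSum_ofReal_im _ _ (hwS n)) (by positivity)
      (by positivity) (fun k => hB k w hw) hrM hsum v
    simpa only [hΨc _ w hw, shiftedPowerSum] using hfin

/-! ### Fourier coefficients and the differentiation operator -/

theorem memLp_liftIoc_of_continuous {g : ℝ → ℂ} (hg : Continuous g) (p : ENNReal) :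
    MemLp (liftIoc 1 (-(1 / 2)) g) p (haarAddCircle (T := (1 : ℝ))) := by
  rw [memLp_haarAddCircle_iff]
  apply MemLp.memLp_liftIoc
  obtain ⟨C, hC⟩ := (isCompact_Icc (a := (-(1 / 2) : ℝ))
    (b := -(1 / 2) + 1)).exists_bound_of_continuousOn hg.continuousOn
  refine MemLp.of_bound hg.aestronglyMeasurable C ?_
  exact (ae_restrict_iff' measurableSet_Ioc).2
    (ae_of_all _ fun t ht => hC t (Ioc_subset_Icc_self ht))

/-- The Fourier coefficients on `[-1/2, 1/2]` of a continuous function, as an element of `ℓ²`. -/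
noncomputable def coeffSeq (g : C(ℝ, ℂ)) : ℓ²(ℤ, ℂ) :=
  fourierBasis.repr ((memLp_liftIoc_of_continuous g.continuous 2).toLp _)

theorem coeffSeq_apply (g : C(ℝ, ℂ)) (n : ℤ) :
    coeffSeq g n =
      ∫ t in (-(1 / 2) : ℝ)..(1 / 2), Complex.exp (-(2 * Real.pi * I * n * t)) * g t := by
  rw [coeffSeq, fourierBasis_repr, fourierCoeff_congr_ae (MemLp.coeFn_toLp _),
    fourierCoeff_eq_intervalIntegral _ _ (-(1 / 2)), intervalIntegral.integral_of_le (by norm_num),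
    intervalIntegral.integral_of_le (by norm_num)]
  norm_num
  refine setIntegral_congr_fun measurableSet_Ioc fun t ht => ?_
  have ht' : t ∈ Ioc (-(1 / 2) : ℝ) (-(1 / 2) + 1) := ⟨by linarith [ht.1], by linarith [ht.2]⟩
  simp only
  rw [← liftIoc_coe_apply (f := g) ht', ← Complex.exp_conj]
  simp [Complex.conj_ofNat]

/-- The symbol `-2πit` of differentiation. -/
noncomputable def diffSymbol : C(ℝ, ℂ) := ⟨fun t => -(2 * Real.pi * I * t), by fun_prop⟩

/-- Multiplication by `-2πit` on `L²(-1/2, 1/2)`, acting on Fourier coefficients. -/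
noncomputable def mulSymbol : ℓ²(ℤ, ℂ) →L[ℂ] ℓ²(ℤ, ℂ) :=
  (fourierBasis (T := (1 : ℝ))).repr.toContinuousLinearEquiv.toContinuousLinearMap ∘L
    ((ContinuousLinearMap.mul ℂ ℂ).holderL haarAddCircle ⊤ 2 2
      ((memLp_liftIoc_of_continuous diffSymbol.continuous ⊤).toLp _)) ∘L
    (fourierBasis (T := (1 : ℝ))).repr.symm.toContinuousLinearEquiv.toContinuousLinearMap

theorem mulSymbol_coeffSeq (g : C(ℝ, ℂ)) :
    mulSymbol (coeffSeq g) = coeffSeq (diffSymbol * g) := by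
  simp only [mulSymbol, coeffSeq, ContinuousLinearMap.comp_apply]
  change fourierBasis.repr _ = _
  congr 1
  change (ContinuousLinearMap.mul ℂ ℂ).holderL haarAddCircle ⊤ 2 2 _
    (fourierBasis.repr.symm (fourierBasis.repr _)) = _
  rw [LinearIsometryEquiv.symm_apply_apply, ContinuousLinearMap.holderL_apply_apply]
  apply Lp.ext
  filter_upwards [ContinuousLinearMap.coeFn_holder (r := 2) (ContinuousLinearMap.mul ℂ ℂ)
    ((memLp_liftIoc_of_continuous diffSymbol.continuous ⊤).toLp _)
    ((memLp_liftIoc_of_continuous g.continuous 2).toLp _),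
    (memLp_liftIoc_of_continuous diffSymbol.continuous ⊤).coeFn_toLp,
    (memLp_liftIoc_of_continuous g.continuous 2).coeFn_toLp,
    (memLp_liftIoc_of_continuous (diffSymbol * g).continuous 2).coeFn_toLp] with x h1 h2 h3 h4
  rw [h1, h2, h3, h4]
  rfl

theorem mulSymbol_pow_coeffSeq (g : C(ℝ, ℂ)) (k : ℕ) :
    (mulSymbol ^ k) (coeffSeq g) = coeffSeq (diffSymbol ^ k * g) := by
  induction k with
  | zero => simp
  | succ k ih =>
    rw [pow_succ' diffSymbol, mul_assoc, ← mulSymbol_coeffSeq, ← ih, pow_succ']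
    rfl

theorem single_eq_coeffSeq (n : ℤ) :
    lp.single 2 n (1 : ℂ) = coeffSeq ⟨fun t => exp (2 * Real.pi * I * n * t), by fun_prop⟩ := by
  rw [← HilbertBasis.repr_self (fourierBasis (T := (1 : ℝ))), coeffSeq, coe_fourierBasis]
  congr 1
  apply Lp.ext
  filter_upwards [coeFn_fourierLp 2 n, (memLp_liftIoc_of_continuous
    (g := fun t => exp (2 * Real.pi * I * n * t)) (by fun_prop) 2).coeFn_toLp] with x h1 h2
  rw [h1]
  refine Eq.trans ?_ h2.symm
  obtain ⟨t, ht, rfl⟩ : ∃ t ∈ Ioc (-(1 / 2) : ℝ) (-(1 / 2) + 1), (t : AddCircle (1 : ℝ)) = x :=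
    ⟨_, (equivIoc 1 (-(1 / 2)) x).2, (equivIoc 1 (-(1 / 2))).symm_apply_apply x⟩
  rw [liftIoc_coe_apply ht, fourier_coe_apply]
  norm_num

/-- The symbol satisfies `conj σ(t) = σ(-t)`, so `t ↦ -t` on the symmetric interval shows each
matrix entry equals its conjugate. -/
theorem mulSymbol_single_mem_realSeq (n : ℤ) : mulSymbol (lp.single 2 n 1) ∈ realSeq := by
  intro m
  rw [single_eq_coeffSeq, mulSymbol_coeffSeq, coeffSeq_apply, ← Complex.conj_eq_iff_im,
    ← intervalIntegral.intervalIntegral_conj]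
  conv_rhs => rw [← neg_neg (1 / 2 : ℝ), ← intervalIntegral.integral_comp_neg, neg_neg]
  refine intervalIntegral.integral_congr fun t _ => ?_
  simp [diffSymbol, ← Complex.exp_conj, Complex.conj_ofNat]

/-- Taylor expansion at the integers of the Fourier transform of a function supported in
`(-1/2, 1/2)`. -/
theorem hasSum_fourier_add {g : C(ℝ, ℂ)} (hg : tsupport g ⊆ Ioo (-(1 / 2) : ℝ) (1 / 2)) (n : ℤ)
    (x : ℝ) :
    HasSum (fun k : ℕ => (x : ℂ) ^ k / k ! * (mulSymbol ^ k) (coeffSeq g) n)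
      (𝓕 (g : ℝ → ℂ) (n + x)) := by
  have hF : 𝓕 (g : ℝ → ℂ) (n + x) = ∫ t in (-(1 / 2) : ℝ)..(1 / 2),
      exp (-(2 * Real.pi * I * n * t)) * (exp (x * diffSymbol t) * g t) := by
    rw [Real.fourier_real_eq_integral_exp_smul,
      intervalIntegral.integral_eq_integral_of_support_subset]
    · congr 1
      ext t
      rw [smul_eq_mul, ← mul_assoc, ← Complex.exp_add]
      congr 2
      simp only [diffSymbol, ContinuousMap.coe_mk]
      push_cast
      ring
    · intro t ht
      have : t ∈ Function.support g := by
        intro h0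
        apply ht
        simp [h0]
      exact Ioo_subset_Ioc_self (hg (subset_tsupport _ this))
  rw [hF]
  have hk : ∀ k : ℕ, (x : ℂ) ^ k / k ! * (mulSymbol ^ k) (coeffSeq g) n =
      ∫ t in (-(1 / 2) : ℝ)..(1 / 2),
        exp (-(2 * Real.pi * I * n * t)) * ((x * diffSymbol t) ^ k / k ! * g t) := by
    intro k
    rw [mulSymbol_pow_coeffSeq, coeffSeq_apply, ← intervalIntegral.integral_const_mul]
    congr 1
    ext t
    simp only [ContinuousMap.mul_apply, ContinuousMap.pow_apply]
    ring
  simp only [hk]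
  obtain ⟨C, hC⟩ := (isCompact_Icc (a := (-(1 / 2) : ℝ)) (b := 1 / 2)).exists_bound_of_continuousOn
    g.continuous.continuousOn
  apply intervalIntegral.hasSum_integral_of_dominated_convergence
    (bound := fun k _ => (|x| * Real.pi) ^ k / k ! * C)
  · intro k
    exact Continuous.aestronglyMeasurable (by fun_prop)
  · intro k
    refine ae_of_all _ fun t ht => ?_
    rw [uIoc_of_le (by norm_num)] at ht
    have h1 : ‖exp (-(2 * Real.pi * I * n * t))‖ = 1 := by
      rw [Complex.norm_exp]; simp
    have h2 : ‖diffSymbol t‖ ≤ Real.pi := by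
      have : ‖diffSymbol t‖ = 2 * Real.pi * |t| := by
        simp [diffSymbol, abs_of_pos Real.pi_pos]
      rw [this]
      have : |t| ≤ 1 / 2 := abs_le.2 ⟨by linarith [ht.1], ht.2⟩
      nlinarith [Real.pi_pos]
    rw [norm_mul, h1, one_mul, norm_mul, norm_div, norm_pow, norm_mul, Complex.norm_real,
      Complex.norm_natCast, Real.norm_eq_abs]
    gcongr
    exact hC t (Ioc_subset_Icc_self ht)
  · refine ae_of_all _ fun t _ => ?_
    exact (Real.summable_pow_div_factorial _).mul_right C
  · exact intervalIntegrable_const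
  · refine ae_of_all _ fun t _ => ?_
    refine HasSum.mul_left _ (HasSum.mul_right _ ?_)
    have := NormedSpace.expSeries_div_hasSum_exp (x * diffSymbol t)
    rwa [← Complex.exp_eq_exp_ℂ] at this

/-! ### Poisson summation, temperate growth and assembly -/

theorem deltaMeasure_range {ι : Type*} {a : ι → ℝ} (ha : Function.Injective a) :
    deltaMeasure (range a) = Measure.sum fun i => Measure.dirac (a i) := by
  rw [deltaMeasure, ← Measure.sum_comp_equiv (Equiv.ofInjective a ha)]
  rfl

theorem fourier_derivCLM_apply (f : 𝓢(ℝ, ℂ)) (t : ℝ) :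
    𝓕 (SchwartzMap.derivCLM ℂ ℂ f) t = 2 * Real.pi * I * t * 𝓕 f t := by
  have h := congrFun (Real.fourier_deriv (f := f) f.integrable f.differentiable
    (SchwartzMap.derivCLM ℂ ℂ f).integrable) t
  rw [SchwartzMap.fourier_coe, SchwartzMap.fourier_coe]
  exact h

/-- Poisson summation with quadratic weights for functions supported in `(-1/2, 1/2)`. -/
theorem tsum_sq_add_one_mul_fourier {f : 𝓢(ℝ, ℂ)}
    (hf : tsupport f ⊆ Ioo (-(1 / 2) : ℝ) (1 / 2)) :
    ∑' n : ℤ, ((n : ℂ) ^ 2 + 1) * 𝓕 f (n : ℝ) = f 0 - 1 / (4 * (Real.pi : ℂ) ^ 2) *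
      SchwartzMap.derivCLM ℂ ℂ (SchwartzMap.derivCLM ℂ ℂ f) 0 := by
  set D := SchwartzMap.derivCLM ℂ ℂ with hD
  set g : 𝓢(ℝ, ℂ) := f - (1 / (4 * (Real.pi : ℂ) ^ 2)) • D (D f) with hg
  have hpi : (Real.pi : ℂ) ≠ 0 := by exact_mod_cast Real.pi_ne_zero
  have hFg : ∀ t : ℝ, 𝓕 g t = ((t : ℂ) ^ 2 + 1) * 𝓕 f t := by
    intro t
    have h1 : 𝓕 g = 𝓕 f - (1 / (4 * (Real.pi : ℂ) ^ 2)) • 𝓕 (D (D f)) := by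
      rw [hg, sub_eq_add_neg, ← neg_smul, FourierTransform.fourier_add,
        FourierTransform.fourier_smul, neg_smul, ← sub_eq_add_neg]
    rw [h1, sub_apply, smul_apply, hD, fourier_derivCLM_apply,
      fourier_derivCLM_apply, smul_eq_mul]
    field_simp
    ring_nf
    simp only [I_sq]
    ring
  -- The support contains no nonzero integer, so one side of Poisson summation reduces to `g 0`.
  have hzero : ∀ n : ℤ, n ≠ 0 → g (0 + n) = 0 := by
    intro n hn
    have hmem : (0 + n : ℝ) ∉ tsupport f := by
      intro h
      obtain ⟨h1, h2⟩ := hf h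
      have h3 : (-1 : ℝ) < n := by linarith
      have h4 : (n : ℝ) < 1 := by linarith
      have h5 : -1 < n := by exact_mod_cast h3
      have h6 : n < 1 := by exact_mod_cast h4
      omega
    have hmem' : (0 + n : ℝ) ∉ tsupport (D (D f)) := fun h =>
      hmem (SchwartzMap.tsupport_derivCLM_subset ℂ _ (SchwartzMap.tsupport_derivCLM_subset ℂ _ h))
    rw [hg, sub_apply, smul_apply, image_eq_zero_of_notMem_tsupport hmem,
      image_eq_zero_of_notMem_tsupport hmem']
    simp
  have hP := SchwartzMap.tsum_eq_tsum_fourier g 0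
  rw [tsum_eq_single 0 hzero] at hP
  have h2 : ∀ n : ℤ, 𝓕 g (n : ℝ) * fourier n ((0 : ℝ) : UnitAddCircle) =
      ((n : ℂ) ^ 2 + 1) * 𝓕 f (n : ℝ) := by
    intro n
    rw [hFg, QuotientAddGroup.mk_zero, fourier_eval_zero, mul_one, Complex.ofReal_intCast]
  rw [tsum_congr h2] at hP
  rw [← hP, hg]
  simp

theorem summable_one_div_sq_add_one : Summable fun n : ℤ => 1 / ((n : ℝ) ^ 2 + 1) := by
  -- The shift by `1/2` keeps the denominator nonzero at every integer.
  have h := ((Real.summable_one_div_int_add_rpow (1 / 2) 2).2 (by norm_num)).mul_left 2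
  refine Summable.of_nonneg_of_le (fun n => by positivity) (fun n => ?_) h
  have h0 : ((n : ℝ) + 1 / 2) ≠ 0 := by
    intro h
    have : (2 * n + 1 : ℝ) = 0 := by linarith
    have : 2 * n + 1 = 0 := by exact_mod_cast this
    omega
  have h1 : 0 < ((n : ℝ) + 1 / 2) ^ 2 := by positivity
  rw [Real.rpow_ofNat, sq_abs, mul_one_div, div_le_div_iff₀ (by positivity) h1]
  nlinarith [sq_nonneg ((n : ℝ) - 1 / 2)]

/-- Clusters of `n ^ 2 + 1` points around the integers `n` have temperate growth. -/
theorem summable_cluster_rpow {x : ∀ n : ℤ, Fin (n.natAbs ^ 2 + 1) → ℝ}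
    (hx : ∀ n i, |x n i| < 1 / 2) :
    Summable fun p : Σ n : ℤ, Fin (n.natAbs ^ 2 + 1) =>
      (1 + ‖(p.1 : ℝ) + x p.1 p.2‖) ^ (-((4 : ℕ) : ℝ)) := by
  have hb : ∀ p : Σ n : ℤ, Fin (n.natAbs ^ 2 + 1),
      (1 + ‖(p.1 : ℝ) + x p.1 p.2‖) ^ (-((4 : ℕ) : ℝ)) ≤ 16 / ((p.1 : ℝ) ^ 2 + 1) ^ 2 := by
    rintro ⟨n, i⟩
    have h1 : |(n : ℝ)| ≤ |(n : ℝ) + x n i| + |x n i| := by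
      simpa using abs_sub ((n : ℝ) + x n i) (x n i)
    have h2 : 1 / 2 + |(n : ℝ)| ≤ 1 + ‖(n : ℝ) + x n i‖ := by
      rw [Real.norm_eq_abs]; linarith [hx n i]
    have h3 : ((n : ℝ) ^ 2 + 1) / 4 ≤ (1 + ‖(n : ℝ) + x n i‖) ^ 2 := by
      have h4 : (1 / 2 + |(n : ℝ)|) ^ 2 ≤ (1 + ‖(n : ℝ) + x n i‖) ^ 2 := by gcongr
      nlinarith [sq_abs (n : ℝ), abs_nonneg (n : ℝ)]
    rw [Real.rpow_neg (by positivity), Real.rpow_natCast, inv_eq_one_div,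
      div_le_div_iff₀ (by positivity) (by positivity)]
    have h5 : (((n : ℝ) ^ 2 + 1) / 4) ^ 2 ≤ ((1 + ‖(n : ℝ) + x n i‖) ^ 2) ^ 2 := by gcongr
    nlinarith [h5]
  refine Summable.of_nonneg_of_le (fun p => by positivity) hb ?_
  rw [summable_sigma_of_nonneg fun p => by positivity]
  refine ⟨fun n => Summable.of_finite, ?_⟩
  refine (summable_one_div_sq_add_one.mul_left 16).congr fun n => ?_
  simp only
  rw [tsum_fintype, Finset.sum_const, Finset.card_univ, Fintype.card_fin, nsmul_eq_mul]
  have : ((n.natAbs ^ 2 + 1 : ℕ) : ℝ) = (n : ℝ) ^ 2 + 1 := by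
    rw [Nat.cast_add, Nat.cast_pow, Nat.cast_natAbs, Int.cast_abs, sq_abs, Nat.cast_one]
  rw [this]
  field_simp

theorem theorem5p1 (ε : ℝ) (hε : 0 < ε) :
    ∃ Λ : Set ℝ, IsSquareCluster ε Λ ∧
      ∃ _ : (deltaMeasure Λ).HasTemperateGrowth,
        EqualIn (𝓕 (deltaMeasure Λ).toTemperedDistribution)
          (TemperedDistribution.delta (0 : ℝ) -
            (1 / (4 * (Real.pi : ℂ) ^ 2)) •
              TemperedDistribution.derivCLM ℂ
                (TemperedDistribution.derivCLM ℂ (TemperedDistribution.delta (0 : ℝ))))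
          (Ioo (-(1 / 2) : ℝ) (1 / 2)) := by
  obtain ⟨x, hxinj, hxε, hx⟩ := exists_annihilating_clusters (fun n => n.natAbs ^ 2 + 1)
    (fun n => Nat.succ_pos _) mulSymbol mulSymbol_single_mem_realSeq
    -- Offsets below `1/2` let `round` recover the cluster index, so distinct clusters are disjoint.
    (ε := min ε (1 / 2)) (by positivity)
  have hx2 : ∀ n i, |x n i| < 1 / 2 := fun n i => (hxε n i).trans_le (min_le_right _ _)
  set a : (Σ n : ℤ, Fin (n.natAbs ^ 2 + 1)) → ℝ := fun p => p.1 + x p.1 p.2 with ha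
  have hround : ∀ p, round (a p) = p.1 := by
    intro p
    obtain ⟨h1, h2⟩ := abs_lt.1 (hx2 p.1 p.2)
    rw [round_eq_iff]
    constructor <;> simp only [ha] <;> linarith
  have hainj : Function.Injective a := by
    rintro ⟨n, i⟩ ⟨m, j⟩ h
    obtain rfl : n = m := by
      have h1 := hround ⟨n, i⟩
      rw [h, hround] at h1
      exact h1.symm
    congr 1
    exact hxinj n (by simpa [ha] using h)
  have hmeas := deltaMeasure_range hainj
  have hint : (deltaMeasure (range a)).HasTemperateGrowth := by
    -- Quartic decay against `n² + 1` points per cluster leaves a multiple of `1 / (n² + 1)`.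
    refine ⟨4, ?_⟩
    rw [hmeas]
    refine integrable_sum_measure (fun p => integrable_dirac (by simp)) ?_
    refine (summable_cluster_rpow hx2).congr fun p => ?_
    rw [integral_dirac, Real.norm_of_nonneg (Real.rpow_nonneg (by positivity) _)]
  refine ⟨range a, ⟨fun n => Finset.univ.image fun i => a ⟨n, i⟩, ?_, fun n => ⟨?_, ?_⟩⟩, hint, ?_⟩
  · ext y
    simp
  · intro y hy
    obtain ⟨i, -, rfl⟩ := Finset.mem_image.1 hy
    have h1 := abs_lt.1 ((hxε n i).trans_le (min_le_left _ _))
    exact ⟨by simp only [ha]; linarith [h1.1], by simp only [ha]; linarith [h1.2]⟩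
  · rw [Finset.card_image_of_injective _ fun i j h => by simpa using hainj h]
    simp
  · intro f hf
    have hsum : HasSum (fun p => 𝓕 f (a p)) (∫ y, 𝓕 f y ∂deltaMeasure (range a)) := by
      have h1 : Integrable (fun y => 𝓕 f y) (deltaMeasure (range a)) := (𝓕 f).integrable
      rw [hmeas] at h1 ⊢
      simpa using hasSum_integral_measure h1
    have hsum' := hsum.sigma fun n => hasSum_fintype _
    -- The Taylor remainder of each cluster is its term in the annihilated sum, so subtracting that
    -- sum moves all points back to `n`.
    have hterm : ∀ n : ℤ, ∑ i, 𝓕 f (a ⟨n, i⟩) -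
        ∑' k : ℕ, (∑ i, (x n i : ℂ) ^ (k + 1) / (k + 1)!) *
          (mulSymbol ^ (k + 1)) (coeffSeq (f : C(ℝ, ℂ))) n = ((n : ℂ) ^ 2 + 1) * 𝓕 f (n : ℝ) := by
      intro n
      have h1 : ∀ i, HasSum (fun k : ℕ => (x n i : ℂ) ^ (k + 1) / (k + 1)! *
          (mulSymbol ^ (k + 1)) (coeffSeq (f : C(ℝ, ℂ))) n) (𝓕 f (a ⟨n, i⟩) - 𝓕 f (n : ℝ)) := by
        intro i
        have h2 := hasSum_fourier_add (g := (f : C(ℝ, ℂ))) hf n (x n i)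
        have h0 := hasSum_fourier_add (g := (f : C(ℝ, ℂ))) hf n 0
        rw [Complex.ofReal_zero, add_zero] at h0
        -- At offset `0` only the `k = 0` term survives; it equals `𝓕 f n`.
        have e0 := h0.unique (hasSum_single 0 fun k hk => by simp [hk])
        rw [← hasSum_nat_add_iff' 1] at h2
        simp only [Finset.range_one, Finset.sum_singleton, pow_zero] at h2 e0
        rw [← e0] at h2
        exact h2
      have h3 := hasSum_sum fun i (_ : i ∈ Finset.univ) => h1 i
      simp only [← Finset.sum_mul] at h3
      rw [h3.tsum_eq, Finset.sum_sub_distrib, sub_sub_cancel, Finset.sum_const, Finset.card_univ,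
        Fintype.card_fin, nsmul_eq_mul]
      congr 1
      rw [Nat.cast_add, Nat.cast_pow, Nat.cast_natAbs, Nat.cast_one, ← Int.cast_pow, sq_abs,
        Int.cast_pow]
    have hfin := hsum'.sub (hx (coeffSeq (f : C(ℝ, ℂ))))
    simp only [hterm, sub_zero] at hfin
    have := hfin.tsum_eq.symm.trans (tsum_sq_add_one_mul_fourier hf)
    simp [this]
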